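/- Let $\Phi$ be a reduced, irreducible, crystallographic finite root system spanning a Euclidean space $V$ with inner product $(\cdot,\cdot)$, with simple roots $\alpha_1,\dots,\alpha_n$, positive roots $\Phi^+$ and coroots $\alpha^\vee=2\alpha/(\alpha,\alpha)$. All transformations of $V$ act on the right. Let $W$ be the Weyl group, generated by the reflections $(x)s_\alpha=x-(x,\alpha)\alpha^\vee$, $\alpha\in\Phi$, and let $\ell$ be the length function of $W$ with respect to the simple reflections $s_i=s_{\alpha_i}$. Let $Q^\vee$ be the lattice spanned by the coroots, $(x)t_\lambda=x+\lambda$ the translation by $\lambda\in Q^\vee$, and $W_a=W\ltimes Q^\vee$ the affine Weyl group. An element $w\in W_a$ is identified with the alcove $(A_0)w$, where $A_0=\{x\in V\mid 0<(x,\alpha)<1\text{ for all }\alpha\in\Phi^+\}$. Let $J\subseteq\{1,\dots,n\}$. Put $W_J=\langle s_j\mid j\in J\rangle$, let $\Phi_J^+\subseteq\Phi^+$ be the set of positive roots that are combinations of the $\alpha_j$, $j\in J$, put $Q_J^\vee=\bigoplus_{j\in J}\mathbb Z\alpha_j^\vee$ and $\widetilde W_J=W_J\ltimes Q_J^\vee$,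 and let $W^J$ be the set of the elements of $W$ that have minimal length in their left coset $wW_J$. Let $$\mathcal A_J=\{x\in V\mid 0<(x,\alpha)<1\text{ for all }\alpha\in\Phi_J^+\},$$ and for $x\in W_a$ write $x\in\mathcal A_J$ if $(A_0)x\subseteq\mathcal A_J$. Then for every $x\in W_a$ there is exactly one $w\in\widetilde W_J$ with $xw\in\mathcal A_J$; write $p_J(x)=xw$. For $x\in\mathcal A_J$ and $\alpha\in Q^\vee$, the element $x\bullet t_{\bar\alpha}:=p_J(xt_\alpha)\in\mathcal A_J$ depends only on $x$ and the class $\bar\alpha$ of $\alpha$ modulo $Q_J^\vee$. Moreover $W^J\subseteq\mathcal A_J$, and the map $$W^J\times Q^\vee/Q_J^\vee\to\mathcal A_J,\qquad (u,\bar\alpha)\mapsto u\bullet t_{\bar\alpha},$$ is a bijection onto the set of alcoves (elements of $W_a$) lying in $\mathcal A_J$. -/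

import Mathlib

noncomputable section

namespace JAlcove

variable {ι V : Type*} [NormedAddCommGroup V] [InnerProductSpace ℝ V]

/-- The root pairing `P` lives in the Euclidean space `V`: roots and coroots are paired by the
inner product and `α^∨ = 2α/(α,α)`, so that `P.reflection i` is the orthogonal reflection
`x ↦ x - (x, α_i) α_i^∨`. -/
structure IsEuclidean (P : RootPairing ι ℝ V V) : Prop where
  toLinearMap_apply : ∀ x y : V, P.toLinearMap x y = inner ℝ x y
  coroot_eq : ∀ i : ι, P.coroot i = (2 / inner ℝ (P.root i) (P.root i)) • P.root i

/-- The group of affine transformations of `V`, acting on `V` from the right: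
in `w * w'`, the transformation `w` is applied first. -/
abbrev RightAff (V : Type*) [NormedAddCommGroup V] [InnerProductSpace ℝ V] : Type _ :=
  (V ≃ᵃ[ℝ] V)ᵐᵒᵖ

/-- The right action `(x)w` of an affine transformation `w` on a point `x`. -/
def act (x : V) (w : RightAff V) : V := w.unop x

/-- The translation `(x)t_β = x + β`. -/
def transl (β : V) : RightAff V := MulOpposite.op (AffineEquiv.constVAdd ℝ V β)

/-- The linear reflection `s_α` for the root `α = P.root i`. -/
def refl (P : RootPairing ι ℝ V V) (i : ι) : RightAff V :=
  MulOpposite.op (P.reflection i).toAffineEquiv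

/-- The Weyl group `W`, generated by the reflections in all roots. -/
def weylGroup (P : RootPairing ι ℝ V V) : Subgroup (RightAff V) :=
  Subgroup.closure (Set.range (refl P))

/-- The coroot lattice `Q^∨`. -/
def corootLattice (P : RootPairing ι ℝ V V) : AddSubgroup V :=
  AddSubgroup.closure (Set.range P.coroot)

/-- The affine Weyl group `W_a = W ⋉ Q^∨`, generated by `W` and the translations by `Q^∨`. -/
def affineWeylGroup (P : RootPairing ι ℝ V V) : Subgroup (RightAff V) :=
  weylGroup P ⊔ Subgroup.closure (transl '' (corootLattice P : Set V))

/-- The parabolic subgroup `W_J`, generated by the `s_j` for `j ∈ J`. -/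
def parabolic (P : RootPairing ι ℝ V V) (J : Set ι) : Subgroup (RightAff V) :=
  Subgroup.closure (refl P '' J)

/-- The lattice `Q^∨_J`, spanned by the coroots `α_j^∨` for `j ∈ J`. -/
def parabolicLattice (P : RootPairing ι ℝ V V) (J : Set ι) : AddSubgroup V :=
  AddSubgroup.closure (P.coroot '' J)

/-- The affine Weyl group `W_J ⋉ Q^∨_J`, generated by `W_J` and the translations by `Q^∨_J`. -/
def affineParabolic (P : RootPairing ι ℝ V V) (J : Set ι) : Subgroup (RightAff V) :=
  parabolic P J ⊔ Subgroup.closure (transl '' (parabolicLattice P J : Set V))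

/-- The quotient group `Q^∨ / Q^∨_J`. -/
abbrev LatticeQuotient (P : RootPairing ι ℝ V V) (J : Set ι) : Type _ :=
  corootLattice P ⧸ (parabolicLattice P J).addSubgroupOf (corootLattice P)

/-- The class `ᾱ` of `α ∈ Q^∨` modulo `Q^∨_J`. -/
def latticeClass (P : RootPairing ι ℝ V V) (J : Set ι) (α : corootLattice P) :
    LatticeQuotient P J := QuotientAddGroup.mk α

/-- The length of `w` with respect to the simple reflections of the base `b`: the least length
of a word in the simple reflections whose product is `w`. -/
def length (P : RootPairing ι ℝ V V) (b : P.Base) (w : RightAff V) : ℕ :=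
  sInf {k | ∃ l : List ι, (∀ i ∈ l, i ∈ b.support) ∧ l.length = k ∧ (l.map (refl P)).prod = w}

/-- The set `W^J` of the elements of `W` that have minimal length in their left coset `w W_J`. -/
def minCosetReps (P : RootPairing ι ℝ V V) (b : P.Base) (J : Set ι) : Set (RightAff V) :=
  {w | w ∈ weylGroup P ∧ ∀ v ∈ parabolic P J, length P b w ≤ length P b (w * v)}

/-- The positive roots `Φ_J^+` of `W_J`: the roots that are nonnegative integral combinations of
the simple roots `α_j`, `j ∈ J`. For `J` the set of all simple roots, these are all the
positive roots. -/
def posRoots (P : RootPairing ι ℝ V V) (J : Set ι) : Set ι :=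
  {i | P.root i ∈ AddSubmonoid.closure (P.root '' J)}

/-- The region `{x ∈ V | 0 < (x, α) < 1 for all α ∈ Φ_J^+}`: the fundamental `J`-alcove as a subset
of `V`, and the fundamental alcove `A₀` when `J` is the set of all simple roots. -/
def region (P : RootPairing ι ℝ V V) (J : Set ι) : Set V :=
  {x | ∀ i ∈ posRoots P J, 0 < inner ℝ x (P.root i) ∧ inner ℝ x (P.root i) < 1}

/-- The alcoves lying in the fundamental `J`-alcove `𝒜_J`. As usual, the alcove `(A₀)x` is
identified with the element `x` of `W_a`. -/
def fundAlcove (P : RootPairing ι ℝ V V) (b : P.Base) (J : Set ι) : Set (RightAff V) :=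
  {x | x ∈ affineWeylGroup P ∧ ∀ y ∈ region P b.support, act y x ∈ region P J}

open Classical in
/-- The folding map `p_J`: `p_J(x) = xw`, where `w` is the element of `W_J ⋉ Q^∨_J` such that
`xw ∈ 𝒜_J` (with the dummy value `x` if no such `w` exists). -/
def fold (P : RootPairing ι ℝ V V) (b : P.Base) (J : Set ι) (x : RightAff V) : RightAff V :=
  if h : ∃ w ∈ affineParabolic P J, x * w ∈ fundAlcove P b J then x * h.choose else x

/-- The pseudo-translation `u • t_ᾱ = p_J(u t_α)`, where `α` is a representative of `ᾱ`. -/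
def pseudoTransl (P : RootPairing ι ℝ V V) (b : P.Base) (J : Set ι) (u : RightAff V)
    (a : LatticeQuotient P J) : RightAff V :=
  fold P b J (u * transl ((Quotient.out a : corootLattice P) : V))

end JAlcove

end

/-!
The hyperplanes `(x, α) = k` with `α ∈ Φ_J` and `k ∈ ℤ` are encoded by affine roots `(i, k)`,
standing for the functions `x ↦ (x, α_i) + k`. The group `W̃_J = W_J ⋉ Q^∨_J` acts simply
transitively on the connected components of their complement, one of which is the region defining
`𝒜_J`. This is proved as follows. The simple affine roots are the `α_j`, `j ∈ J`, and the `1 - θ`,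
where `θ` runs over the maximal roots of `Φ_J`. A simple affine reflection makes only its own root
negative (`eq_of_affPos_of_not_affPos_affAct`), which rests on the fact that a positive root other
than `θ` pairs with `θ^∨` to `0` or `1` (`IsMaxRoot.pairingIn_cases`). A descent on affine roots
shows that the simple affine reflections generate `W̃_J`
(`IsEuclidean.affineParabolic_eq_closure`). Crossing walls moves every generic point into the region
(`IsEuclidean.exists_act_mem_region`), and the exchange property of words (`exists_shorter_word`)
shows that only the identity moves a point of the region into the region
(`IsEuclidean.eq_one_of_act_mem_region`).

An alcove is determined by the signs of the affine roots on it, so it lies in `𝒜_J` as soon as one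
of its points does. Hence every `x ∈ W_a` is folded into `𝒜_J` by exactly one element of `W̃_J`, and
`p_J` is constant on the left cosets `x W̃_J`. Since `t_α t_β = t_{α + β}`, the element `p_J(x t_α)`
depends only on the class of `α` modulo `Q^∨_J`.

The exchange property in `W` shows that an element `u` of minimal length in `u W_J` makes no
`α_j`, `j ∈ J`, negative, and therefore `W^J ⊆ 𝒜_J` (`IsEuclidean.minCosetReps_subset`). Together
with simple transitivity this implies that each coset of `W_J` contains only one element of `W^J`.
For the bijection, write `x ∈ 𝒜_J` as `x = u' t_β = u t_{β v} v⁻¹` with `u = u' v ∈ W^J` and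
`v ∈ W_J`, so that `x = p_J(u t_{β v})`. Conversely, if `u t_α` and `u' t_α'` lie in the same coset
of `W̃_J`, then comparing linear parts gives `u = u'`, and comparing translations gives
`α ≡ α'` modulo `Q^∨_J`.
-/

noncomputable section

namespace JAlcove

/-! ### Words in involutions and the exchange property -/

section Words

variable {G R : Type*} [Group G] {r : R → G} {op : R → R → R} {pos : R → Prop} {T : Set R}

theorem exists_word_of_mem_closure (hsq : ∀ t, r t * r t = 1) {g : G}
    (hg : g ∈ Subgroup.closure (r '' T)) :
    ∃ l : List R, (∀ t ∈ l, t ∈ T) ∧ (l.map r).prod = g := by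
  induction hg using Subgroup.closure_induction with
  | mem x hx =>
    obtain ⟨t, ht, rfl⟩ := hx
    exact ⟨[t], by simpa using ht, by simp⟩
  | one => exact ⟨[], by simp, by simp⟩
  | mul x y _ _ hx hy =>
    obtain ⟨l, hl, rfl⟩ := hx
    obtain ⟨l', hl', rfl⟩ := hy
    refine ⟨l ++ l', fun t ht ↦ ?_, by simp⟩
    rcases List.mem_append.mp ht with h | h
    exacts [hl t h, hl' t h]
  | inv x _ hx =>
    obtain ⟨l, hl, rfl⟩ := hx
    refine ⟨l.reverse, by simpa using hl, ?_⟩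
    rw [List.prod_inv_reverse, List.map_map, List.map_reverse]
    have : (fun x ↦ x⁻¹) ∘ r = r := funext fun t ↦ inv_eq_of_mul_eq_one_left (hsq t)
    rw [this]

theorem map_foldr_op (hsq : ∀ t, r t * r t = 1) (hop : ∀ t a, r (op t a) = r t * r a * r t)
    (l : List R) (c : R) :
    r (l.foldr op c) = (l.map r).prod * r c * (l.map r).prod⁻¹ := by
  induction l with
  | nil => simp
  | cons t l ih =>
    have : (r t)⁻¹ = r t := inv_eq_of_mul_eq_one_left (hsq t)
    simp [hop, ih, mul_assoc, this]

/-- The exchange property. If a word in simple reflections turns the positive root `c` into a root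
that is not positive, then some letter `t` of the word is the first to do so; it acts on its own
root, so that right multiplication by the reflection in `c` deletes this letter. -/
theorem exists_shorter_word (hsq : ∀ t, r t * r t = 1)
    (hop : ∀ t a, r (op t a) = r t * r a * r t)
    (hflip : ∀ t ∈ T, ∀ a, pos a → ¬ pos (op t a) → a = t) {c : R} (hc : pos c) (l : List R)
    (hl : ∀ t ∈ l, t ∈ T) (hneg : ¬ pos (l.foldr op c)) :
    ∃ l' : List R, (∀ t ∈ l', t ∈ T) ∧ l'.length + 1 = l.length ∧
      (l'.map r).prod = (l.map r).prod * r c := by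
  induction l with
  | nil => exact absurd hc hneg
  | cons t l ih =>
    have hl' : ∀ u ∈ l, u ∈ T := fun u hu ↦ hl u (List.mem_cons_of_mem _ hu)
    by_cases hp : pos (l.foldr op c)
    · refine ⟨l, hl', by simp, ?_⟩
      have h1 := hflip t (hl t (by simp)) _ hp hneg
      have h2 := map_foldr_op hsq hop l c
      rw [h1] at h2
      simp [h2, mul_assoc, hsq]
    · obtain ⟨l', h1, h2, h3⟩ := ih hl' hp
      refine ⟨t :: l', ?_, by simp [h2], by simp [h3, mul_assoc]⟩
      intro u hu
      rcases List.mem_cons.mp hu with rfl | hu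
      exacts [hl _ (by simp), h1 u hu]

end Words

/-! ### Affine transformations and affine reflections -/

section Affine

variable {ι V : Type*} [NormedAddCommGroup V] [InnerProductSpace ℝ V]

@[simp] theorem act_mul (x : V) (g h : RightAff V) : act x (g * h) = act (act x g) h := rfl

@[simp] theorem act_one (x : V) : act x 1 = x := rfl

@[simp] theorem act_transl (x β : V) : act x (transl β) = x + β := by
  simp [act, transl, add_comm]

theorem ext_act {g h : RightAff V} (H : ∀ x, act x g = act x h) : g = h :=
  MulOpposite.unop_injective (AffineEquiv.ext H)

theorem transl_add (β γ : V) : transl (β + γ) = transl β * transl γ :=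
  ext_act fun x ↦ by simp [add_assoc]

theorem transl_zero : transl (0 : V) = 1 := ext_act fun x ↦ by simp

theorem transl_neg (β : V) : transl (-β) = (transl β)⁻¹ :=
  eq_inv_of_mul_eq_one_left <| by rw [← transl_add, neg_add_cancel, transl_zero]

variable {P : RootPairing ι ℝ V V}

theorem inner_root_self_pos (i : ι) :
    0 < (inner ℝ (P.root i) (P.root i) : ℝ) :=
  real_inner_self_pos.mpr (P.ne_zero i)

theorem IsEuclidean.inner_coroot (hP : IsEuclidean P) (i j : ι) :
    inner ℝ (P.coroot i) (P.root j) = P.pairing j i := by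
  rw [← P.root_coroot_eq_pairing, hP.toLinearMap_apply, real_inner_comm]

theorem IsEuclidean.act_refl (hP : IsEuclidean P) (x : V) (i : ι) :
    act x (refl P i) = x - (inner ℝ x (P.root i) : ℝ) • P.coroot i := by
  change P.reflection i x = _
  have h : P.coroot' i x = inner ℝ x (P.coroot i) := hP.toLinearMap_apply x (P.coroot i)
  rw [P.reflection_apply, h, hP.coroot_eq, inner_smul_right, smul_smul, mul_comm]

theorem refl_mul_self (i : ι) : refl P i * refl P i = 1 :=
  ext_act fun x ↦ P.reflection_same i x

theorem refl_reflectionPerm (t i : ι) :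
    refl P (P.reflectionPerm t i) = refl P t * refl P i * refl P t :=
  ext_act fun x ↦ by
    change P.reflection _ x = P.reflection t (P.reflection i (P.reflection t x))
    rw [P.reflection_reflectionPerm]; rfl

/-- The value at `x` of the affine root `a = (i, k)`, the affine function `x ↦ (x, α_i) + k`. -/
def affEval (P : RootPairing ι ℝ V V) (a : ι × ℤ) (x : V) : ℝ :=
  inner ℝ x (P.root a.1) + a.2

/-- The affine reflection in the zero set of the affine root `a`. -/
def affRefl (P : RootPairing ι ℝ V V) (a : ι × ℤ) : RightAff V :=
  refl P a.1 * transl (-(a.2 : ℝ) • P.coroot a.1)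

/-- The action on affine roots of the affine reflection in `t`. -/
def affAct (P : RootPairing ι ℝ V V) [P.IsCrystallographic] (t a : ι × ℤ) : ι × ℤ :=
  (P.reflectionPerm t.1 a.1, a.2 - t.2 * P.pairingIn ℤ a.1 t.1)

theorem IsEuclidean.act_affRefl (hP : IsEuclidean P) (x : V) (a : ι × ℤ) :
    act x (affRefl P a) = x - affEval P a x • P.coroot a.1 := by
  simp only [affRefl, act_mul, act_transl, hP.act_refl, affEval]
  module

theorem IsEuclidean.affEval_sub_smul_coroot (hP : IsEuclidean P) (x : V) (c : ℝ) (t a : ι × ℤ) :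
    affEval P a (x - c • P.coroot t.1) = affEval P a x - c * P.pairing a.1 t.1 := by
  simp only [affEval, inner_sub_left, real_inner_smul_left, hP.inner_coroot]
  ring

theorem IsEuclidean.affEval_affRefl_self (hP : IsEuclidean P) (x : V) (a : ι × ℤ) :
    affEval P a (act x (affRefl P a)) = - affEval P a x := by
  rw [hP.act_affRefl, hP.affEval_sub_smul_coroot, P.pairing_same]
  ring

theorem IsEuclidean.affRefl_mul_self (hP : IsEuclidean P) (a : ι × ℤ) :
    affRefl P a * affRefl P a = 1 := by
  refine ext_act fun x ↦ ?_
  rw [act_mul, hP.act_affRefl (act x _), hP.affEval_affRefl_self, hP.act_affRefl]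
  simp

theorem coroot_reflectionPerm_eq (t i : ι) :
    P.coroot (P.reflectionPerm t i) = P.coroot i - (P.pairing t i) • P.coroot t := by
  rw [P.coroot_reflectionPerm, P.coreflection_apply_coroot]

variable [P.IsCrystallographic]

theorem pairing_eq_intCast (i j : ι) : P.pairing i j = (P.pairingIn ℤ i j : ℝ) :=
  (P.algebraMap_pairingIn ℤ i j).symm

theorem root_reflectionPerm_eq (t i : ι) :
    P.root (P.reflectionPerm t i) = P.root i - (P.pairingIn ℤ i t) • P.root t := by
  rw [P.root_reflectionPerm, P.reflection_apply_root' ℤ]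

theorem IsEuclidean.affEval_affAct (hP : IsEuclidean P) (t a : ι × ℤ) (x : V) :
    affEval P (affAct P t a) x = affEval P a (act x (affRefl P t)) := by
  rw [hP.act_affRefl, hP.affEval_sub_smul_coroot, pairing_eq_intCast]
  simp only [affEval, affAct, root_reflectionPerm_eq, inner_sub_right]
  rw [← Int.cast_smul_eq_zsmul ℝ, real_inner_smul_right]
  push_cast
  ring

theorem IsEuclidean.affRefl_affAct (hP : IsEuclidean P) (t a : ι × ℤ) :
    affRefl P (affAct P t a) = affRefl P t * affRefl P a * affRefl P t := by
  refine ext_act fun x ↦ ?_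
  rw [hP.act_affRefl, hP.affEval_affAct]
  simp only [act_mul]
  rw [hP.act_affRefl (act (act x _) _) t, hP.act_affRefl (act x _) a,
    hP.affEval_sub_smul_coroot _ _ a t, hP.affEval_affRefl_self, hP.act_affRefl x t]
  simp only [affAct, coroot_reflectionPerm_eq]
  module

theorem IsEuclidean.affEval_foldr_affAct (hP : IsEuclidean P) (l : List (ι × ℤ)) (a : ι × ℤ)
    (x : V) :
    affEval P (l.foldr (affAct P) a) x = affEval P a (act x (l.map (affRefl P)).prod) := by
  induction l generalizing x with
  | nil => simp
  | cons t l ih => simp [hP.affEval_affAct, ih]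

theorem affRefl_reflectionPerm_self (i : ι) (k : ℤ) (hP : IsEuclidean P) :
    affRefl P (P.reflectionPerm i i, -k) = affRefl P (i, k) := by
  refine ext_act fun x ↦ ?_
  rw [hP.act_affRefl, hP.act_affRefl]
  simp only [affEval, root_reflectionPerm_eq, coroot_reflectionPerm_eq, P.pairing_same,
    P.pairingIn_same]
  rw [← Int.cast_smul_eq_zsmul ℝ]
  simp only [inner_sub_right, real_inner_smul_right]
  push_cast
  module

end Affine

/-! ### The roots of a parabolic subsystem -/

section Parabolic

variable {ι V : Type*} [NormedAddCommGroup V] [InnerProductSpace ℝ V]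
variable {P : RootPairing ι ℝ V V} {b : P.Base} {J : Set ι}

/-- The root of index `i` lies in the parabolic subsystem `Φ_J`, that is, in the `ℤ`-span of the
simple roots `α_j`, `j ∈ J`. -/
def IsParabolicRoot (P : RootPairing ι ℝ V V) (J : Set ι) (i : ι) : Prop :=
  P.root i ∈ AddSubgroup.closure (P.root '' J)

theorem isParabolicRoot_of_mem {j : ι} (hj : j ∈ J) : IsParabolicRoot P J j :=
  AddSubgroup.subset_closure ⟨j, hj, rfl⟩

theorem root_mem_closure_of_mem {j : ι} (hj : j ∈ J) :
    P.root j ∈ AddSubmonoid.closure (P.root '' J) :=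
  AddSubmonoid.subset_closure ⟨j, hj, rfl⟩

theorem IsParabolicRoot.reflectionPerm [P.IsCrystallographic] {t i : ι}
    (ht : IsParabolicRoot P J t) (hi : IsParabolicRoot P J i) :
    IsParabolicRoot P J (P.reflectionPerm t i) := by
  rw [IsParabolicRoot, root_reflectionPerm_eq]
  exact sub_mem hi (zsmul_mem ht _)

theorem isPos_neg_iff (i : ι) : b.IsPos (P.reflectionPerm i i) ↔ ¬ b.IsPos i :=
  RootPairing.Base.IsPos.neg_iff_not b i

theorem root_neg (i : ι) : P.root (P.reflectionPerm i i) = - P.root i := by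
  rw [P.root_reflectionPerm, P.reflection_apply_self]

theorem isParabolicRoot_neg_iff (i : ι) :
    IsParabolicRoot P J (P.reflectionPerm i i) ↔ IsParabolicRoot P J i := by
  rw [IsParabolicRoot, root_neg, neg_mem_iff, IsParabolicRoot]

theorem exists_intCoeff_of_mem_closure (hJ : J ⊆ (b.support : Set ι)) {x : V}
    (hx : x ∈ AddSubgroup.closure (P.root '' J)) :
    ∃ f : ι → ℤ, f.support ⊆ J ∧ x = ∑ j ∈ b.support, f j • P.root j := by
  classical
  induction hx using AddSubgroup.closure_induction with
  | mem x hx =>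
    obtain ⟨j, hj, rfl⟩ := hx
    refine ⟨Pi.single j 1, ?_, ?_⟩
    · intro k hk
      by_cases h : k = j
      · exact h ▸ hj
      · simp [h] at hk
    · rw [Finset.sum_eq_single_of_mem j (hJ hj) (by simp_all)]
      simp
  | zero => exact ⟨0, by simp, by simp⟩
  | add x y _ _ hx hy =>
    obtain ⟨f, hf, rfl⟩ := hx
    obtain ⟨g, hg, rfl⟩ := hy
    exact ⟨f + g, (Function.support_add f g).trans (Set.union_subset hf hg),
      by simp [add_smul, Finset.sum_add_distrib]⟩
  | neg x _ hx =>
    obtain ⟨f, hf, rfl⟩ := hx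
    exact ⟨-f, by simpa using hf, by simp⟩

theorem inner_nonneg_of_mem_closure {x y : V} (h : ∀ j ∈ J, 0 ≤ (inner ℝ x (P.root j) : ℝ))
    (hy : y ∈ AddSubmonoid.closure (P.root '' J)) : 0 ≤ (inner ℝ x y : ℝ) := by
  induction hy using AddSubmonoid.closure_induction with
  | mem y hy => obtain ⟨j, hj, rfl⟩ := hy; exact h j hj
  | zero => simp
  | add y z _ _ hy hz => rw [inner_add_right]; exact add_nonneg hy hz

theorem eq_zero_or_inner_pos_of_mem_closure {x y : V}
    (h : ∀ j ∈ J, 0 < (inner ℝ x (P.root j) : ℝ))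
    (hy : y ∈ AddSubmonoid.closure (P.root '' J)) : y = 0 ∨ 0 < (inner ℝ x y : ℝ) := by
  induction hy using AddSubmonoid.closure_induction with
  | mem y hy => obtain ⟨j, hj, rfl⟩ := hy; exact Or.inr (h j hj)
  | zero => exact Or.inl rfl
  | add y z _ _ hy hz =>
    rcases hy with rfl | hy
    · simpa using hz
    · rcases hz with rfl | hz
      · simpa using Or.inr hy
      · rw [inner_add_right]; exact Or.inr (add_pos hy hz)

theorem inner_pos_of_mem_posRoots {x : V} (h : ∀ j ∈ J, 0 < (inner ℝ x (P.root j) : ℝ)) {i : ι}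
    (hi : i ∈ posRoots P J) : 0 < (inner ℝ x (P.root i) : ℝ) :=
  (eq_zero_or_inner_pos_of_mem_closure h hi).resolve_left (P.ne_zero i)

theorem mem_posRoots_iff (hJ : J ⊆ (b.support : Set ι)) {i : ι} :
    i ∈ posRoots P J ↔ IsParabolicRoot P J i ∧ b.IsPos i := by
  constructor
  · intro hi
    have hi' : IsParabolicRoot P J i :=
      (AddSubmonoid.closure_le (S := (AddSubgroup.closure (P.root '' J)).toAddSubmonoid)).mpr
        AddSubgroup.subset_closure hi
    refine ⟨hi', ?_⟩
    have key : ∀ y ∈ AddSubmonoid.closure (P.root '' J),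
        ∃ f : ι → ℤ, 0 ≤ f ∧ y = ∑ j ∈ b.support, f j • P.root j := by
      classical
      intro y hy
      induction hy using AddSubmonoid.closure_induction with
      | mem y hy =>
        obtain ⟨j, hj, rfl⟩ := hy
        refine ⟨Pi.single j 1, by simp, ?_⟩
        rw [Finset.sum_eq_single_of_mem j (hJ hj) (by simp_all)]
        simp
      | zero => exact ⟨0, le_rfl, by simp⟩
      | add y z _ _ hy hz =>
        obtain ⟨f, hf, rfl⟩ := hy
        obtain ⟨g, hg, rfl⟩ := hz
        exact ⟨f + g, add_nonneg hf hg, by simp [add_smul, Finset.sum_add_distrib]⟩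
    obtain ⟨f, hf, h⟩ := key _ hi
    rw [b.isPos_iff', RootPairing.Base.height_eq_sum h]
    exact Finset.sum_nonneg fun j _ ↦ hf j
  · rintro ⟨hi, hpos⟩
    obtain ⟨f, hf, h⟩ := exists_intCoeff_of_mem_closure hJ hi
    have h0 : 0 ≤ f := by
      rcases b.pos_or_neg_of_sum_smul_root_mem f ⟨i, h⟩ (hf.trans hJ) with h1 | h1
      · exact h1.le
      · rw [b.isPos_iff, RootPairing.Base.height_eq_sum h] at hpos
        exact absurd hpos (not_lt.mpr (Finset.sum_nonpos fun j _ ↦ h1.le j))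
    change P.root i ∈ AddSubmonoid.closure (P.root '' J)
    rw [h]
    refine sum_mem fun j _ ↦ ?_
    by_cases hj : j ∈ J
    · obtain ⟨n, hn⟩ := Int.eq_ofNat_of_zero_le (h0 j)
      rw [hn, natCast_zsmul]
      exact nsmul_mem (root_mem_closure_of_mem hj) n
    · have : f j = 0 := by
        by_contra h; exact hj (hf h)
      simp [this]

theorem mem_posRoots_support_iff {i : ι} : i ∈ posRoots P (b.support : Set ι) ↔ b.IsPos i := by
  rw [mem_posRoots_iff subset_rfl, and_iff_right_iff_imp]
  intro _
  have h := b.root_mem_span_int i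
  rwa [← Submodule.mem_toAddSubgroup, Submodule.span_int_eq_addSubgroupClosure] at h

theorem height_neg (i : ι) : b.height (P.reflectionPerm i i) = - b.height i :=
  b.height_reflectionPerm_self i

/-- Otherwise the root, a positive combination of simple roots of `J`, would have a nonpositive
inner product with itself. -/
theorem exists_mem_inner_pos {i : ι} (hi : i ∈ posRoots P J) :
    ∃ j ∈ J, 0 < (inner ℝ (P.root i) (P.root j) : ℝ) := by
  by_contra! h
  have := inner_nonneg_of_mem_closure (P := P) (J := J) (x := -P.root i)
    (fun j hj ↦ by rw [inner_neg_left]; linarith [h j hj]) hi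
  rw [inner_neg_left] at this
  linarith [inner_root_self_pos (P := P) i]

/-- The vector `ρ^∨`, which pairs to `1` with every simple root and hence computes heights. -/
theorem exists_inner_root_eq_height [FiniteDimensional ℝ V] [P.IsRootSystem] (b : P.Base) :
    ∃ x : V, ∀ i, (inner ℝ x (P.root i) : ℝ) = b.height i := by
  let f : V →ₗ[ℝ] ℝ := b.toWeightBasis.constr ℝ (fun _ ↦ (1 : ℝ))
  have : CompleteSpace V := FiniteDimensional.complete ℝ V
  refine ⟨(InnerProductSpace.toDual ℝ V).symm f.toContinuousLinearMap, fun i ↦ ?_⟩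
  rw [InnerProductSpace.toDual_symm_apply]
  have hf : ∀ j ∈ b.support, f (P.root j) = 1 := fun j hj ↦ by
    have := b.toWeightBasis.constr_basis ℝ (fun _ ↦ (1 : ℝ)) ⟨j, hj⟩
    rwa [b.toWeightBasis_apply] at this
  obtain ⟨g, -, -, hg⟩ := b.exists_root_eq_sum_int i
  rw [RootPairing.Base.height_eq_sum hg, hg, LinearMap.coe_toContinuousLinearMap', map_sum,
    Int.cast_sum]
  exact Finset.sum_congr rfl fun j hj ↦ by rw [map_zsmul, hf j hj]; simp

/-- The root of index `θ` is maximal among the positive roots of `Φ_J` for the dominance order.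
There is one such root for each irreducible component of `Φ_J`. -/
def IsMaxRoot (P : RootPairing ι ℝ V V) (J : Set ι) (θ : ι) : Prop :=
  θ ∈ posRoots P J ∧
    ∀ i ∈ posRoots P J, P.root i - P.root θ ∈ AddSubmonoid.closure (P.root '' J) → i = θ

theorem exists_isMaxRoot [Finite ι] [FiniteDimensional ℝ V] [P.IsRootSystem]
    (hJ : J ⊆ (b.support : Set ι)) {i : ι} (hi : i ∈ posRoots P J) :
    ∃ θ, IsMaxRoot P J θ ∧ P.root θ - P.root i ∈ AddSubmonoid.closure (P.root '' J) := by
  obtain ⟨x, hx⟩ := exists_inner_root_eq_height b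
  have hxJ : ∀ j ∈ J, 0 < (inner ℝ x (P.root j) : ℝ) := fun j hj ↦ by
    rw [hx, RootPairing.Base.height_one_of_mem_support (hJ hj)]; simp
  obtain ⟨θ, ⟨h1, h2⟩, h3⟩ := Set.exists_max_image
    {k | k ∈ posRoots P J ∧ P.root k - P.root i ∈ AddSubmonoid.closure (P.root '' J)}
    (fun k ↦ (inner ℝ x (P.root k) : ℝ)) (Set.toFinite _) ⟨i, hi, by simp⟩
  refine ⟨θ, ⟨h1, fun k hk hkθ ↦ ?_⟩, h2⟩
  have hki : P.root k - P.root i ∈ AddSubmonoid.closure (P.root '' J) := by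
    have := add_mem hkθ h2
    rwa [sub_add_sub_cancel] at this
  rcases eq_zero_or_inner_pos_of_mem_closure hxJ hkθ with h | h
  · exact P.root.injective (sub_eq_zero.mp h)
  · rw [inner_sub_right] at h
    linarith [h3 k ⟨hk, hki⟩]

variable [P.IsCrystallographic]

theorem IsEuclidean.pairingIn_pos_iff (hP : IsEuclidean P) (i j : ι) :
    0 < P.pairingIn ℤ i j ↔ 0 < (inner ℝ (P.root i) (P.root j) : ℝ) := by
  rw [← Int.cast_pos (R := ℝ), ← pairing_eq_intCast, ← hP.inner_coroot, hP.coroot_eq,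
    real_inner_smul_left, real_inner_comm]
  have := inner_root_self_pos (P := P) j
  rw [mul_pos_iff_of_pos_left (by positivity), real_inner_comm]

theorem height_reflectionPerm (t i : ι) :
    b.height (P.reflectionPerm t i) = b.height i - P.pairingIn ℤ i t * b.height t := by
  have : P.root (P.reflectionPerm t i) = P.root i + (- P.pairingIn ℤ i t) • P.root t := by
    rw [root_reflectionPerm_eq]; module
  rw [b.height_add_zsmul this]
  simp [sub_eq_add_neg]

variable [Finite ι]

theorem refl_mem_parabolic_and_coroot_mem [P.IsReduced] (hP : IsEuclidean P)
    (hJ : J ⊆ (b.support : Set ι)) {i : ι} (hi : i ∈ posRoots P J) :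
    refl P i ∈ parabolic P J ∧ P.coroot i ∈ parabolicLattice P J := by
  generalize hN : (b.height i).toNat = N
  induction N using Nat.strongRecOn generalizing i with
  | ind n ih =>
    by_cases hiJ : i ∈ J
    · exact ⟨Subgroup.subset_closure ⟨i, hiJ, rfl⟩, AddSubgroup.subset_closure ⟨i, hiJ, rfl⟩⟩
    obtain ⟨j, hj, hpos⟩ := exists_mem_inner_pos hi
    rw [← hP.pairingIn_pos_iff] at hpos
    have hij : i ≠ j := fun h ↦ hiJ (h ▸ hj)
    have hi2 := (mem_posRoots_iff hJ).mp hi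
    have hs : P.reflectionPerm j i ∈ posRoots P J := (mem_posRoots_iff hJ).mpr
      ⟨(isParabolicRoot_of_mem hj).reflectionPerm hi2.1, hi2.2.reflectionPerm (hJ hj) hij⟩
    have hh := height_reflectionPerm (b := b) j i
    rw [RootPairing.Base.height_one_of_mem_support (hJ hj)] at hh
    have h1 : 0 < b.height i := hi2.2
    obtain ⟨h2, h3⟩ := ih _ (by omega) hs rfl
    have hrj : refl P j ∈ parabolic P J := Subgroup.subset_closure ⟨j, hj, rfl⟩
    have hcj : P.coroot j ∈ parabolicLattice P J := AddSubgroup.subset_closure ⟨j, hj, rfl⟩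
    have hback : i = P.reflectionPerm j (P.reflectionPerm j i) := by simp
    constructor
    · rw [hback, refl_reflectionPerm]
      exact mul_mem (mul_mem hrj h2) hrj
    · rw [hback, coroot_reflectionPerm_eq, pairing_eq_intCast, Int.cast_smul_eq_zsmul]
      exact sub_mem h3 (zsmul_mem hcj _)

/-- The reflection in a maximal root `θ` of `Φ_J` fixes each positive root of `Φ_J` other than `θ`
or makes it negative by subtracting `θ` once. -/
theorem IsMaxRoot.pairingIn_cases (hJ : J ⊆ (b.support : Set ι)) {θ i : ι}
    (hθ : IsMaxRoot P J θ) (hi : i ∈ posRoots P J) (hne : i ≠ θ) :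
    P.pairingIn ℤ i θ = 0 ∨
      P.pairingIn ℤ i θ = 1 ∧ ¬ b.IsPos (P.reflectionPerm θ i) := by
  have hθ1 := (mem_posRoots_iff hJ).mp hθ.1
  -- no root is the sum of `θ` and a positive root
  have hadd : ∀ k ∈ posRoots P J, P.root k + P.root θ ∉ Set.range P.root := by
    rintro k hk ⟨m, hm⟩
    have hk1 := (mem_posRoots_iff hJ).mp hk
    have hm1 : m ∈ posRoots P J := (mem_posRoots_iff hJ).mpr
      ⟨by rw [IsParabolicRoot, hm]; exact add_mem hk1.1 hθ1.1, hk1.2.add hθ1.2 hm⟩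
    have := hθ.2 m hm1 (by rw [hm, add_sub_cancel_right]; exact hk)
    rw [this, right_eq_add] at hm
    exact P.ne_zero k hm
  have hnonneg : ∀ k ∈ posRoots P J, 0 ≤ P.pairingIn ℤ k θ := by
    intro k hk
    by_contra! h
    refine hadd k hk (P.root_add_root_mem_of_pairingIn_neg h fun h' ↦ ?_)
    rw [P.root_eq_neg_iff] at h'
    have h2 := ((mem_posRoots_iff hJ).mp hk).2
    rw [h', isPos_neg_iff] at h2
    exact h2 hθ1.2
  rcases (hnonneg i hi).eq_or_lt with h0 | h0
  · exact Or.inl h0.symm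
  right
  have hi1 := (mem_posRoots_iff hJ).mp hi
  obtain ⟨γ, hγ⟩ := P.root_sub_root_mem_of_pairingIn_pos h0 hne
  have hγJ : IsParabolicRoot P J γ := by
    rw [IsParabolicRoot, hγ]; exact sub_mem hi1.1 hθ1.1
  have hγneg : ¬ b.IsPos γ := by
    intro h
    have : P.root i - P.root θ ∈ AddSubmonoid.closure (P.root '' J) :=
      hγ ▸ (mem_posRoots_iff hJ).mpr ⟨hγJ, h⟩
    exact hne (hθ.2 i hi this)
  have hδ : P.reflectionPerm γ γ ∈ posRoots P J := (mem_posRoots_iff hJ).mpr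
    ⟨(isParabolicRoot_neg_iff γ).mpr hγJ, (isPos_neg_iff γ).mpr hγneg⟩
  have hpδ : P.pairingIn ℤ (P.reflectionPerm γ γ) θ = 2 - P.pairingIn ℤ i θ := by
    have h1 := P.pairingIn_eq_add_of_root_eq_add (S := ℤ) (k := i) (i := γ) (j := θ) (l := θ)
      (by rw [hγ]; abel)
    rw [P.pairingIn_reflectionPerm_self_left, P.pairingIn_same] at *
    omega
  have h2 := hnonneg _ hδ
  have h3 : P.pairingIn ℤ i θ ≠ 2 := by
    -- otherwise `s_θ α_i = α_i - 2θ`, the negative of the forbidden root `(θ - α_i) + θ`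
    intro h
    refine hadd _ hδ ⟨P.reflectionPerm (P.reflectionPerm θ i) (P.reflectionPerm θ i), ?_⟩
    rw [root_neg, root_neg, root_reflectionPerm_eq, hγ, h]
    module
  have h4 : P.pairingIn ℤ i θ = 1 := by omega
  refine ⟨h4, ?_⟩
  have : P.reflectionPerm θ i = γ := by
    apply P.root.injective
    rw [root_reflectionPerm_eq, hγ, h4, one_smul]
  rwa [this]

end Parabolic

/-! ### Positive and simple affine roots -/

section AffineRoots

variable {ι V : Type*} [NormedAddCommGroup V] [InnerProductSpace ℝ V]
variable {P : RootPairing ι ℝ V V} {b : P.Base} {J : Set ι}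

/-- The affine root `a` of `Φ_J` is positive, that is, positive on the alcove `region P J`. -/
def AffPos (b : P.Base) (J : Set ι) (a : ι × ℤ) : Prop :=
  IsParabolicRoot P J a.1 ∧ (1 ≤ a.2 ∨ a.2 = 0 ∧ b.IsPos a.1)

/-- The simple affine roots of `Φ_J`: the simple roots of `J`, and `1 - θ` for the maximal
roots `θ`. Their zero sets are the walls of the alcove `region P J`. -/
def affSimple (P : RootPairing ι ℝ V V) (J : Set ι) : Set (ι × ℤ) :=
  {t | t.1 ∈ J ∧ t.2 = 0} ∪ {t | ∃ θ, IsMaxRoot P J θ ∧ t = (P.reflectionPerm θ θ, 1)}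

theorem affPos_of_mem_affSimple (hJ : J ⊆ (b.support : Set ι)) {t : ι × ℤ}
    (ht : t ∈ affSimple P J) : AffPos b J t := by
  rcases ht with ⟨h1, h2⟩ | ⟨θ, hθ, rfl⟩
  · exact ⟨isParabolicRoot_of_mem h1,
      Or.inr ⟨h2, RootPairing.Base.isPos_of_mem_support (hJ h1)⟩⟩
  · exact ⟨(isParabolicRoot_neg_iff θ).mpr ((mem_posRoots_iff hJ).mp hθ.1).1, Or.inl le_rfl⟩

theorem AffPos.affEval_pos (hJ : J ⊆ (b.support : Set ι)) {a : ι × ℤ} (ha : AffPos b J a) {x : V}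
    (hx : x ∈ region P J) : 0 < affEval P a x := by
  obtain ⟨h1, h2⟩ := ha
  unfold affEval
  by_cases hpos : b.IsPos a.1
  · have h3 := (hx a.1 ((mem_posRoots_iff hJ).mpr ⟨h1, hpos⟩)).1
    have h4 : (0 : ℤ) ≤ a.2 := by omega
    have h5 : (0 : ℝ) ≤ a.2 := by exact_mod_cast h4
    linarith
  · have h3 := (hx (P.reflectionPerm a.1 a.1) ((mem_posRoots_iff hJ).mpr
      ⟨(isParabolicRoot_neg_iff _).mpr h1, (isPos_neg_iff _).mpr hpos⟩)).2
    rw [root_neg, inner_neg_right] at h3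
    have h4 : (1 : ℤ) ≤ a.2 := h2.resolve_right fun h ↦ hpos h.2
    have h5 : (1 : ℝ) ≤ a.2 := by exact_mod_cast h4
    linarith

theorem affPos_or_affPos_neg {i : ι} (hi : IsParabolicRoot P J i) (k : ℤ) :
    AffPos b J (i, k) ∨ AffPos b J (P.reflectionPerm i i, -k) := by
  rcases lt_trichotomy k 0 with h | h | h
  · exact Or.inr ⟨(isParabolicRoot_neg_iff i).mpr hi, Or.inl (by simp only; omega)⟩
  · by_cases hpos : b.IsPos i
    · exact Or.inl ⟨hi, Or.inr ⟨h, hpos⟩⟩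
    · exact Or.inr ⟨(isParabolicRoot_neg_iff i).mpr hi,
        Or.inr ⟨by simp [h], (isPos_neg_iff i).mpr hpos⟩⟩
  · exact Or.inl ⟨hi, Or.inl h⟩

variable [P.IsCrystallographic] [Finite ι]

/-- A simple affine reflection makes no positive affine root negative except its own. -/
theorem eq_of_affPos_of_not_affPos_affAct [P.IsReduced] (hJ : J ⊆ (b.support : Set ι))
    {t : ι × ℤ} (ht : t ∈ affSimple P J) {a : ι × ℤ} (ha : AffPos b J a)
    (hneg : ¬ AffPos b J (affAct P t a)) : a = t := by
  have hpar : IsParabolicRoot P J (affAct P t a).1 :=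
    (affPos_of_mem_affSimple hJ ht).1.reflectionPerm ha.1
  obtain ⟨i, k⟩ := a
  obtain ⟨hi, hk⟩ := ha
  simp only at hi hk
  have hneg2 : ¬ (1 ≤ (affAct P t (i, k)).2 ∨ (affAct P t (i, k)).2 = 0 ∧
      b.IsPos (affAct P t (i, k)).1) := fun h ↦ hneg ⟨hpar, h⟩
  -- the only delicate values are those of `k` for which the constant term drops to `0`
  rcases ht with ⟨h1, h2⟩ | ⟨θ, hθ, rfl⟩
  · simp only [affAct, h2, zero_mul, sub_zero, not_or, not_and] at hneg2
    obtain ⟨hk0, hpos⟩ := hk.resolve_left hneg2.1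
    by_contra hne
    refine hneg2.2 hk0 (hpos.reflectionPerm (hJ h1) fun h ↦ hne ?_)
    exact Prod.ext h (by simp [hk0, h2])
  · have hθ1 := (mem_posRoots_iff hJ).mp hθ.1
    have hrefl : P.reflectionPerm (P.reflectionPerm θ θ) i = P.reflectionPerm θ i := by
      apply P.root.injective
      rw [root_reflectionPerm_eq _ i, root_reflectionPerm_eq _ i, root_neg,
        P.pairingIn_reflectionPerm_self_right, neg_smul_neg]
    simp only [affAct, hrefl, P.pairingIn_reflectionPerm_self_right, one_mul, sub_neg_eq_add,
      not_or, not_and] at hneg2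
    obtain ⟨hn1, hn2⟩ := hneg2
    by_cases hpos : b.IsPos i
    · have h0 : 0 ≤ k := by omega
      rcases eq_or_ne i θ with rfl | hne
      · rw [P.pairingIn_same] at hn1
        omega
      · rcases hθ.pairingIn_cases hJ ((mem_posRoots_iff hJ).mpr ⟨hi, hpos⟩) hne with hp | ⟨hp, -⟩
        · have hfix : P.reflectionPerm θ i = i := by
            apply P.root.injective
            rw [root_reflectionPerm_eq, hp, zero_smul, sub_zero]
          rw [hfix, hp, add_zero] at hn2
          exact absurd hpos (hn2 (by omega))
        · omega
    · have h1 : 1 ≤ k := hk.resolve_right fun h ↦ hpos h.2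
      rcases eq_or_ne (P.reflectionPerm i i) θ with hiθ | hne
      · have hi' : i = P.reflectionPerm θ θ := by
          apply P.root.injective
          rw [root_neg, ← hiθ, root_neg, neg_neg]
        have hp : P.pairingIn ℤ i θ = -2 := by
          rw [hi', P.pairingIn_reflectionPerm_self_left, P.pairingIn_same]
        have hsi : P.reflectionPerm θ i = θ := by rw [hi']; simp
        rw [hsi, hp] at hn2
        rw [hp] at hn1
        have hk2 : k ≠ 2 := fun h ↦ hn2 (by omega) hθ1.2
        exact Prod.ext hi' (by simp only; omega)
      · have hni := (mem_posRoots_iff hJ).mpr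
          ⟨(isParabolicRoot_neg_iff i).mpr hi, (isPos_neg_iff i).mpr hpos⟩
        have hcases := hθ.pairingIn_cases hJ hni hne
        rw [P.pairingIn_reflectionPerm_self_left] at hcases
        rcases hcases with hp | ⟨hp, hsneg⟩
        · omega
        · have hcomm : P.reflectionPerm θ (P.reflectionPerm i i) =
              P.reflectionPerm (P.reflectionPerm θ i) (P.reflectionPerm θ i) := by
            apply P.root.injective
            rw [root_neg, root_reflectionPerm_eq θ, root_reflectionPerm_eq θ, root_neg,
              P.pairingIn_reflectionPerm_self_left]
            module
          rw [hcomm, isPos_neg_iff, not_not] at hsneg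
          exact absurd hsneg (hn2 (by omega))

/-- For a positive root the simple roots of `J` suffice. If `α_i` is negative, and pairs to at most
`0` with the simple roots, then it pairs negatively with every maximal root above `-α_i`. -/
theorem IsEuclidean.exists_affSimple_pairingIn_pos [FiniteDimensional ℝ V] [P.IsRootSystem]
    (hP : IsEuclidean P) (hJ : J ⊆ (b.support : Set ι)) {i : ι} (hi : IsParabolicRoot P J i) :
    ∃ t ∈ affSimple P J, 0 < P.pairingIn ℤ i t.1 := by
  by_cases hpos : b.IsPos i
  · obtain ⟨j, hj, h⟩ := exists_mem_inner_pos ((mem_posRoots_iff hJ).mpr ⟨hi, hpos⟩)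
    exact ⟨(j, 0), Or.inl ⟨hj, rfl⟩, (hP.pairingIn_pos_iff i j).mpr h⟩
  · by_contra! h
    have hsimple : ∀ j ∈ J, (inner ℝ (P.root i) (P.root j) : ℝ) ≤ 0 := fun j hj ↦
      not_lt.mp <| (hP.pairingIn_pos_iff i j).not.mp (not_lt.mpr (h (j, 0) (Or.inl ⟨hj, rfl⟩)))
    obtain ⟨θ, hθ, hle⟩ := exists_isMaxRoot hJ ((mem_posRoots_iff hJ).mpr
      ⟨(isParabolicRoot_neg_iff i).mpr hi, (isPos_neg_iff i).mpr hpos⟩)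
    have h1 := (hP.pairingIn_pos_iff i (P.reflectionPerm θ θ)).not.mp
      (not_lt.mpr (h _ (Or.inr ⟨θ, hθ, rfl⟩)))
    have h2 := inner_nonneg_of_mem_closure (x := - P.root i)
      (fun j hj ↦ by rw [inner_neg_left]; linarith [hsimple j hj]) hle
    rw [root_neg, inner_neg_right] at h1
    rw [root_neg, inner_sub_right, inner_neg_left, inner_neg_left, inner_neg_right] at h2
    linarith [inner_root_self_pos (P := P) i]

/-- A positive affine root that is not simple becomes smaller, for the measure
`(i, k) ↦ ht(α_i) + N k` with `N` larger than all heights, under some simple affine reflection. So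
the reflections in the simple affine roots generate the reflections in all affine roots. -/
theorem IsEuclidean.affRefl_mem_closure_of_affPos [FiniteDimensional ℝ V] [P.IsRootSystem]
    [P.IsReduced] (hP : IsEuclidean P) (hJ : J ⊆ (b.support : Set ι)) {a : ι × ℤ}
    (ha : AffPos b J a) : affRefl P a ∈ Subgroup.closure (affRefl P '' affSimple P J) := by
  obtain ⟨N, hN⟩ : ∃ N : ℤ, ∀ i, -N < b.height i := by
    obtain ⟨N, hN⟩ := (Set.finite_range b.height).bddBelow
    exact ⟨1 - N, fun i ↦ by linarith [hN ⟨i, rfl⟩]⟩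
  have hN0 : 0 ≤ N := by
    have h1 := hN a.1
    have h2 := hN (P.reflectionPerm a.1 a.1)
    rw [height_neg] at h2
    omega
  have hm : ∀ a, AffPos b J a → 0 < b.height a.1 + N * a.2 := by
    rintro ⟨i, k⟩ ⟨-, h | ⟨h, hpos⟩⟩
    · simp only at h ⊢
      nlinarith [hN i]
    · simp only at h ⊢
      rw [h, mul_zero, add_zero]
      exact hpos
  generalize hn : (b.height a.1 + N * a.2).toNat = n
  induction n using Nat.strongRecOn generalizing a with
  | ind n ih =>
    by_cases has : a ∈ affSimple P J
    · exact Subgroup.subset_closure ⟨a, has, rfl⟩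
    obtain ⟨t, ht, hpair⟩ := hP.exists_affSimple_pairingIn_pos hJ ha.1
    have hta : AffPos b J (affAct P t a) := by
      by_contra h
      exact has (eq_of_affPos_of_not_affPos_affAct hJ ht ha h ▸ ht)
    have hmt := hm t (affPos_of_mem_affSimple hJ ht)
    have hma := hm a ha
    have hlt : b.height (affAct P t a).1 + N * (affAct P t a).2 < b.height a.1 + N * a.2 := by
      simp only [affAct, height_reflectionPerm]
      nlinarith
    have hmem := ih _ (by omega) hta rfl
    have htm : affRefl P t ∈ Subgroup.closure (affRefl P '' affSimple P J) :=
      Subgroup.subset_closure ⟨t, ht, rfl⟩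
    have heq : affRefl P a = affRefl P t * affRefl P (affAct P t a) * affRefl P t := by
      rw [hP.affRefl_affAct]
      simp only [mul_assoc, hP.affRefl_mul_self, mul_one]
      rw [← mul_assoc, hP.affRefl_mul_self, one_mul]
    rw [heq]
    exact mul_mem (mul_mem htm hmem) htm

theorem IsEuclidean.affRefl_mem_closure [FiniteDimensional ℝ V] [P.IsRootSystem]
    [P.IsReduced] (hP : IsEuclidean P) (hJ : J ⊆ (b.support : Set ι)) {i : ι}
    (hi : IsParabolicRoot P J i) (k : ℤ) :
    affRefl P (i, k) ∈ Subgroup.closure (affRefl P '' affSimple P J) := by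
  rcases affPos_or_affPos_neg (b := b) hi k with h | h
  · exact hP.affRefl_mem_closure_of_affPos hJ h
  · rw [← affRefl_reflectionPerm_self i k hP]
    exact hP.affRefl_mem_closure_of_affPos hJ h

theorem transl_mem_of_mem_closure {H : Subgroup (RightAff V)} {s : Set V}
    (h : ∀ β ∈ s, transl β ∈ H) {β : V} (hβ : β ∈ AddSubgroup.closure s) : transl β ∈ H := by
  induction hβ using AddSubgroup.closure_induction with
  | mem β hβ => exact h β hβ
  | zero => rw [transl_zero]; exact one_mem H
  | add β γ _ _ hβ hγ => rw [transl_add]; exact mul_mem hβ hγ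
  | neg β _ hβ => rw [transl_neg]; exact inv_mem hβ

theorem IsEuclidean.affineParabolic_eq_closure [FiniteDimensional ℝ V] [P.IsRootSystem]
    [P.IsReduced] (hP : IsEuclidean P) (hJ : J ⊆ (b.support : Set ι)) :
    affineParabolic P J = Subgroup.closure (affRefl P '' affSimple P J) := by
  have hrefl : ∀ i, affRefl P (i, 0) = refl P i := fun i ↦ by simp [affRefl, transl_zero]
  apply le_antisymm
  · refine sup_le ((Subgroup.closure_le _).mpr ?_) ((Subgroup.closure_le _).mpr ?_)
    · rintro _ ⟨j, hj, rfl⟩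
      exact Subgroup.subset_closure ⟨(j, 0), Or.inl ⟨hj, rfl⟩, hrefl j⟩
    · rintro _ ⟨β, hβ, rfl⟩
      refine transl_mem_of_mem_closure ?_ hβ
      rintro _ ⟨j, hj, rfl⟩
      have h1 := hP.affRefl_mem_closure hJ (isParabolicRoot_of_mem hj) (-1)
      have h0 := hP.affRefl_mem_closure hJ (isParabolicRoot_of_mem hj) 0
      -- a translation is the product of two reflections in parallel hyperplanes
      have : transl (P.coroot j) = affRefl P (j, 0) * affRefl P (j, -1) := by
        simp only [hrefl]
        simp only [affRefl]
        rw [← mul_assoc, refl_mul_self, one_mul]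
        simp
      rw [this]
      exact mul_mem h0 h1
  · refine (Subgroup.closure_le _).mpr ?_
    have key : ∀ i ∈ posRoots P J, ∀ k, affRefl P (i, k) ∈ affineParabolic P J := by
      intro i hi k
      obtain ⟨h1, h2⟩ := refl_mem_parabolic_and_coroot_mem hP hJ hi
      refine mul_mem (Subgroup.mem_sup_left h1)
        (Subgroup.mem_sup_right (Subgroup.subset_closure ⟨_, ?_, rfl⟩))
      simp only
      rw [← Int.cast_neg, Int.cast_smul_eq_zsmul]
      exact zsmul_mem h2 _
    rintro _ ⟨⟨i, k⟩, ht, rfl⟩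
    have hpar := (affPos_of_mem_affSimple hJ ht).1
    by_cases hpos : b.IsPos i
    · exact key i ((mem_posRoots_iff hJ).mpr ⟨hpar, hpos⟩) k
    · rw [← affRefl_reflectionPerm_self i k hP]
      exact key _ ((mem_posRoots_iff hJ).mpr
        ⟨(isParabolicRoot_neg_iff i).mpr hpar, (isPos_neg_iff i).mpr hpos⟩) _

/-! ### Simple transitivity on alcoves -/

/-- An element of the affine Weyl group of `Φ_J` that maps a point of the alcove `region P J`
into this alcove is trivial. By the exchange property, the last letter of a nonempty reduced word
is a wall of the alcove that separates it from its image. -/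
theorem IsEuclidean.eq_one_of_act_mem_region [FiniteDimensional ℝ V] [P.IsRootSystem]
    [P.IsReduced] (hP : IsEuclidean P) (hJ : J ⊆ (b.support : Set ι)) {v : RightAff V}
    (hv : v ∈ affineParabolic P J) {z : V} (hz : z ∈ region P J) (hzv : act z v ∈ region P J) :
    v = 1 := by
  rw [hP.affineParabolic_eq_closure hJ] at hv
  have hex : ∃ n, ∃ l : List (ι × ℤ), (∀ t ∈ l, t ∈ affSimple P J) ∧
      (l.map (affRefl P)).prod = v ∧ l.length = n := by
    obtain ⟨l, h1, h2⟩ := exists_word_of_mem_closure hP.affRefl_mul_self hv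
    exact ⟨_, l, h1, h2, rfl⟩
  classical
  obtain ⟨l, hl, hprod, hlen⟩ := Nat.find_spec hex
  have hmin : ∀ l' : List (ι × ℤ), (∀ t ∈ l', t ∈ affSimple P J) →
      (l'.map (affRefl P)).prod = v → l.length ≤ l'.length := fun l' h1 h2 ↦
    hlen ▸ Nat.find_min' hex ⟨l', h1, h2, rfl⟩
  rcases List.eq_nil_or_concat l with rfl | ⟨l₁, t, rfl⟩
  · simpa using hprod.symm
  exfalso
  rw [List.concat_eq_append] at hl hprod hmin
  have ht : t ∈ affSimple P J := hl t (by simp)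
  have hl₁ : ∀ u ∈ l₁, u ∈ affSimple P J := fun u hu ↦ hl u (by simp [hu])
  have htpos := affPos_of_mem_affSimple hJ ht
  have hp : AffPos b J (l₁.foldr (affAct P) t) := by
    by_contra hneg
    obtain ⟨l', h1, h2, h3⟩ := exists_shorter_word hP.affRefl_mul_self hP.affRefl_affAct
      (fun t ht a ↦ eq_of_affPos_of_not_affPos_affAct hJ ht) htpos l₁ hl₁ hneg
    have := hmin l' h1 (by rw [h3, ← hprod]; simp)
    simp at this
    omega
  have h1 := hp.affEval_pos hJ hz
  have h2 := htpos.affEval_pos hJ hzv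
  rw [hP.affEval_foldr_affAct] at h1
  rw [← hprod] at h2
  simp only [List.map_append, List.map_cons, List.map_nil, List.prod_append, List.prod_cons,
    List.prod_nil, mul_one, act_mul] at h2
  rw [hP.affEval_affRefl_self] at h2
  linarith

/-- A point off the hyperplanes of `Φ_J` is moved into the alcove `region P J` by the affine Weyl
group of `Φ_J`. Crossing a wall that separates the point from the alcove decreases the number of
positive affine roots that are negative at the point. -/
theorem IsEuclidean.exists_act_mem_region [FiniteDimensional ℝ V] [P.IsRootSystem]
    [P.IsReduced] (hP : IsEuclidean P) (hJ : J ⊆ (b.support : Set ι)) {y : V}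
    (hy : ∀ a, affEval P a y ≠ 0) :
    ∃ w ∈ affineParabolic P J, act y w ∈ region P J := by
  rw [hP.affineParabolic_eq_closure hJ]
  let inv : V → Set (ι × ℤ) := fun x ↦ {a | AffPos b J a ∧ affEval P a x < 0}
  have hfin : ∀ x, (inv x).Finite := by
    intro x
    obtain ⟨C, hC⟩ := (Set.finite_range fun i ↦ (-inner ℝ x (P.root i) : ℝ)).bddAbove
    refine Set.Finite.subset (Set.finite_univ.prod (Set.finite_Icc (0 : ℤ) ⌈C⌉)) ?_
    rintro ⟨i, k⟩ ⟨⟨-, h1⟩, h2⟩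
    refine ⟨trivial, by simp only at h1; omega, ?_⟩
    have h3 := hC ⟨i, rfl⟩
    simp only [affEval] at h2 h3
    have : (k : ℝ) ≤ ⌈C⌉ := le_trans (by linarith) (Int.le_ceil C)
    exact_mod_cast this
  generalize hn : (inv y).ncard = n
  induction n using Nat.strongRecOn generalizing y with
  | ind n ih =>
    by_cases hex : ∃ t ∈ affSimple P J, affEval P t y < 0
    · obtain ⟨t, ht, hty⟩ := hex
      have htpos := affPos_of_mem_affSimple hJ ht
      have hinvol : ∀ a, affAct P t (affAct P t a) = a := by
        rintro ⟨i, k⟩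
        have : P.pairingIn ℤ (P.reflectionPerm t.1 i) t.1 = - P.pairingIn ℤ i t.1 := by
          rw [← P.pairingIn_reflectionPerm, P.pairingIn_reflectionPerm_self_right]
        simp [affAct, this]
      have hlt : (inv (act y (affRefl P t))).ncard < n := by
        rw [← hn]
        refine lt_of_le_of_lt ?_ (Set.ncard_sdiff_singleton_lt_of_mem
          (show t ∈ inv y from ⟨htpos, hty⟩) (hfin y))
        -- the reflection in `t` maps the new set injectively into the old one without `t`
        refine Set.ncard_le_ncard_of_injOn (affAct P t) ?_
          (fun a _ a' _ h ↦ by rw [← hinvol a, h, hinvol]) ((hfin y).sdiff)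
        rintro a ⟨ha, hneg⟩
        rw [← hP.affEval_affAct] at hneg
        have hat : a ≠ t := by
          rintro rfl
          rw [hP.affEval_affAct, hP.affEval_affRefl_self] at hneg
          linarith
        refine ⟨⟨?_, hneg⟩, fun h ↦ ?_⟩
        · by_contra h
          exact hat (eq_of_affPos_of_not_affPos_affAct hJ ht ha h)
        · -- `a` would be the negative of the positive affine root `t`
          have h' : affAct P t a = t := h
          have ha' : a = (P.reflectionPerm t.1 t.1, -t.2) := by
            rw [← hinvol a, h']
            exact Prod.ext rfl (by simp only [affAct, P.pairingIn_same]; ring)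
          have h1 := ha.2
          simp only [ha', isPos_neg_iff] at h1
          rcases h1 with h1 | ⟨h1, h1'⟩ <;> rcases htpos.2 with h2 | ⟨h2, h2'⟩
          all_goals first | omega | exact h1' h2'
      obtain ⟨w, hw, hmem⟩ := ih _ hlt (y := act y (affRefl P t))
        (fun a ↦ by rw [← hP.affEval_affAct]; exact hy _) rfl
      exact ⟨affRefl P t * w, mul_mem (Subgroup.subset_closure ⟨t, ht, rfl⟩) hw, hmem⟩
    · push Not at hex
      refine ⟨1, one_mem _, fun i hi ↦ ?_⟩
      rw [act_one]
      refine ⟨inner_pos_of_mem_posRoots (fun j hj ↦ ?_) hi, ?_⟩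
      · have h1 := (hex (j, 0) (Or.inl ⟨hj, rfl⟩)).lt_of_ne (hy _).symm
        simpa [affEval] using h1
      · obtain ⟨θ, hθ, hle⟩ := exists_isMaxRoot hJ hi
        have h1 := (hex _ (Or.inr ⟨θ, hθ, rfl⟩)).lt_of_ne (hy _).symm
        simp only [affEval, root_neg, inner_neg_right, Int.cast_one] at h1
        have h2 := inner_nonneg_of_mem_closure (x := y) (fun j hj ↦ by
          simpa [affEval] using hex (j, 0) (Or.inl ⟨hj, rfl⟩)) hle
        rw [inner_sub_right] at h2
        linarith

end AffineRoots

/-! ### The affine Weyl group and the semidirect product decomposition -/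

section WeylGroup

variable {ι V : Type*} [NormedAddCommGroup V] [InnerProductSpace ℝ V]
variable {P : RootPairing ι ℝ V V} {b : P.Base} {J : Set ι}

theorem parabolic_mono {K : Set ι} (h : J ⊆ K) : parabolic P J ≤ parabolic P K :=
  Subgroup.closure_mono (Set.image_mono h)

theorem parabolicLattice_mono {K : Set ι} (h : J ⊆ K) :
    parabolicLattice P J ≤ parabolicLattice P K :=
  AddSubgroup.closure_mono (Set.image_mono h)

theorem affineParabolic_mono {K : Set ι} (h : J ⊆ K) :
    affineParabolic P J ≤ affineParabolic P K :=
  sup_le_sup (parabolic_mono h)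
    (Subgroup.closure_mono (Set.image_mono (parabolicLattice_mono h)))

theorem transl_mem_affineParabolic {β : V} (hβ : β ∈ parabolicLattice P J) :
    transl β ∈ affineParabolic P J :=
  Subgroup.mem_sup_right (Subgroup.subset_closure ⟨β, hβ, rfl⟩)

theorem exists_eq_transl_of_mem_closure {L : AddSubgroup V} {g : RightAff V}
    (hg : g ∈ Subgroup.closure (transl '' (L : Set V))) : ∃ β ∈ L, g = transl β := by
  induction hg using Subgroup.closure_induction with
  | mem x hx => obtain ⟨β, hβ, rfl⟩ := hx; exact ⟨β, hβ, rfl⟩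
  | one => exact ⟨0, zero_mem L, transl_zero.symm⟩
  | mul x y _ _ hx hy =>
    obtain ⟨β, hβ, rfl⟩ := hx
    obtain ⟨γ, hγ, rfl⟩ := hy
    exact ⟨β + γ, add_mem hβ hγ, (transl_add β γ).symm⟩
  | inv x _ hx =>
    obtain ⟨β, hβ, rfl⟩ := hx
    exact ⟨-β, neg_mem hβ, (transl_neg β).symm⟩

theorem IsEuclidean.act_add_of_mem_parabolic (hP : IsEuclidean P) {v : RightAff V}
    (hv : v ∈ parabolic P J) (x y : V) : act (x + y) v = act x v + act y v := by
  obtain ⟨l, -, rfl⟩ := exists_word_of_mem_closure (refl_mul_self (P := P)) hv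
  clear hv
  induction l generalizing x y with
  | nil => simp
  | cons t l ih =>
    have : act (x + y) (refl P t) = act x (refl P t) + act y (refl P t) := by
      simp only [hP.act_refl, inner_add_left]
      module
    simp [this, ih]

theorem IsEuclidean.act_zero_of_mem_parabolic (hP : IsEuclidean P) {v : RightAff V}
    (hv : v ∈ parabolic P J) : act 0 v = 0 := by
  simpa using hP.act_add_of_mem_parabolic hv 0 0

theorem IsEuclidean.transl_mul_of_mem_parabolic (hP : IsEuclidean P) {v : RightAff V}
    (hv : v ∈ parabolic P J) (β : V) : transl β * v = v * transl (act β v) :=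
  ext_act fun x ↦ by simp [hP.act_add_of_mem_parabolic hv]

theorem IsEuclidean.inner_act_word (hP : IsEuclidean P) (l : List ι) (y : V) (i : ι) :
    (inner ℝ (act y (l.map (refl P)).prod) (P.root i) : ℝ) =
      inner ℝ y (P.root (l.foldr (fun t j ↦ P.reflectionPerm t j) i)) := by
  induction l generalizing y with
  | nil => simp
  | cons t l ih =>
    simp only [List.map_cons, List.prod_cons, act_mul, ih, List.foldr_cons]
    rw [hP.act_refl, P.root_reflectionPerm, P.reflection_apply_root]
    simp only [inner_sub_left, inner_sub_right, real_inner_smul_left, real_inner_smul_right,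
      hP.inner_coroot]
    ring

theorem affEval_neg (i : ι) (k : ℤ) (x : V) :
    affEval P (P.reflectionPerm i i, -k) x = - affEval P (i, k) x := by
  simp only [affEval, root_neg, inner_neg_right, Int.cast_neg]
  ring

theorem exists_mem_posRoots_or_neg (b : P.Base) (i : ι) :
    i ∈ posRoots P (b.support : Set ι) ∨
      P.reflectionPerm i i ∈ posRoots P (b.support : Set ι) := by
  rw [mem_posRoots_support_iff, mem_posRoots_support_iff, isPos_neg_iff]
  exact em _

theorem isParabolicRoot_support (b : P.Base) (i : ι) :
    IsParabolicRoot P (b.support : Set ι) i := by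
  rcases exists_mem_posRoots_or_neg b i with h | h
  · exact ((mem_posRoots_iff subset_rfl).mp h).1
  · exact (isParabolicRoot_neg_iff i).mp ((mem_posRoots_iff subset_rfl).mp h).1

theorem affEval_ne_zero {y : V} (hy : y ∈ region P (b.support : Set ι)) (a : ι × ℤ) :
    affEval P a y ≠ 0 := by
  obtain ⟨i, k⟩ := a
  rcases affPos_or_affPos_neg (b := b) (isParabolicRoot_support b i) k with h | h
  · exact (h.affEval_pos subset_rfl hy).ne'
  · have := h.affEval_pos subset_rfl hy
    rw [affEval_neg] at this
    exact (neg_pos.mp this).ne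

/-- An affine root has constant sign on the fundamental alcove. -/
theorem affEval_pos_of_affEval_pos {y z : V} (hy : y ∈ region P (b.support : Set ι))
    (hz : z ∈ region P (b.support : Set ι)) {a : ι × ℤ} (ha : 0 < affEval P a y) :
    0 < affEval P a z := by
  obtain ⟨i, k⟩ := a
  rcases affPos_or_affPos_neg (b := b) (isParabolicRoot_support b i) k with h | h
  · exact h.affEval_pos subset_rfl hz
  · have := h.affEval_pos subset_rfl hy
    rw [affEval_neg] at this
    linarith

theorem region_support_nonempty [Finite ι] [FiniteDimensional ℝ V] [P.IsRootSystem] (b : P.Base) :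
    (region P (b.support : Set ι)).Nonempty := by
  obtain ⟨x, hx⟩ := exists_inner_root_eq_height b
  obtain ⟨N, hN⟩ := (Set.finite_range b.height).bddAbove
  -- `ρ^∨`, divided by a number larger than all heights
  refine ⟨((|N| + 1 : ℤ) : ℝ)⁻¹ • x, fun i hi ↦ ?_⟩
  have h1 : (0 : ℤ) < b.height i := mem_posRoots_support_iff.mp hi
  have h2 : b.height i < |N| + 1 := by linarith [hN ⟨i, rfl⟩, le_abs_self N]
  have h3 : (0 : ℝ) < (|N| + 1 : ℤ) := by exact_mod_cast h1.trans h2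
  rw [real_inner_smul_left, hx, inv_mul_eq_div, div_lt_one h3]
  exact ⟨div_pos (by exact_mod_cast h1) h3, by exact_mod_cast h2⟩

variable [P.IsCrystallographic]

theorem IsEuclidean.exists_inner_root_eq_intCast (hP : IsEuclidean P) {β : V}
    (hβ : β ∈ parabolicLattice P J) (i : ι) :
    ∃ n : ℤ, (inner ℝ β (P.root i) : ℝ) = n := by
  induction hβ using AddSubgroup.closure_induction with
  | mem x hx =>
    obtain ⟨j, -, rfl⟩ := hx
    exact ⟨P.pairingIn ℤ i j, by rw [hP.inner_coroot, pairing_eq_intCast]⟩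
  | zero => exact ⟨0, by simp⟩
  | add x y _ _ hx hy =>
    obtain ⟨m, hm⟩ := hx
    obtain ⟨n, hn⟩ := hy
    exact ⟨m + n, by rw [inner_add_left, hm, hn, Int.cast_add]⟩
  | neg x _ hx =>
    obtain ⟨n, hn⟩ := hx
    exact ⟨-n, by rw [inner_neg_left, hn, Int.cast_neg]⟩

theorem IsEuclidean.act_mem_parabolicLattice (hP : IsEuclidean P) {v : RightAff V}
    (hv : v ∈ parabolic P J) {β : V} (hβ : β ∈ parabolicLattice P J) :
    act β v ∈ parabolicLattice P J := by
  obtain ⟨l, hl, rfl⟩ := exists_word_of_mem_closure (refl_mul_self (P := P)) hv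
  clear hv
  induction l generalizing β with
  | nil => simpa
  | cons t l ih =>
    simp only [List.map_cons, List.prod_cons, act_mul]
    refine ih ?_ fun u hu ↦ hl u (List.mem_cons_of_mem _ hu)
    obtain ⟨n, hn⟩ := hP.exists_inner_root_eq_intCast hβ t
    rw [hP.act_refl, hn, Int.cast_smul_eq_zsmul]
    exact sub_mem hβ (zsmul_mem
      (show P.coroot t ∈ parabolicLattice P J from
        AddSubgroup.subset_closure ⟨t, hl t (by simp), rfl⟩) n)

/-- Every element of `W_J ⋉ Q^∨_J` is the product of an element of `W_J` and a translation. -/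
theorem IsEuclidean.exists_eq_mul_transl (hP : IsEuclidean P) {g : RightAff V}
    (hg : g ∈ affineParabolic P J) :
    ∃ v ∈ parabolic P J, ∃ β ∈ parabolicLattice P J, g = v * transl β := by
  rw [affineParabolic, Subgroup.sup_eq_closure] at hg
  induction hg using Subgroup.closure_induction with
  | mem x hx =>
    rcases hx with hx | hx
    · exact ⟨x, hx, 0, zero_mem _, by rw [transl_zero, mul_one]⟩
    · obtain ⟨β, hβ, rfl⟩ := exists_eq_transl_of_mem_closure hx
      exact ⟨1, one_mem _, β, hβ, (one_mul _).symm⟩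
  | one => exact ⟨1, one_mem _, 0, zero_mem _, by rw [transl_zero, mul_one]⟩
  | mul x y _ _ hx hy =>
    obtain ⟨v, hv, β, hβ, rfl⟩ := hx
    obtain ⟨u, hu, γ, hγ, rfl⟩ := hy
    refine ⟨v * u, mul_mem hv hu, act β u + γ, add_mem (hP.act_mem_parabolicLattice hu hβ) hγ, ?_⟩
    rw [transl_add, mul_assoc, ← mul_assoc (transl β), hP.transl_mul_of_mem_parabolic hu]
    simp only [mul_assoc]
  | inv x _ hx =>
    obtain ⟨v, hv, β, hβ, rfl⟩ := hx
    refine ⟨v⁻¹, inv_mem hv, act (-β) v⁻¹,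
      hP.act_mem_parabolicLattice (inv_mem hv) (neg_mem hβ), ?_⟩
    rw [mul_inv_rev, ← transl_neg, hP.transl_mul_of_mem_parabolic (inv_mem hv)]

variable [Finite ι] [P.IsReduced]

theorem IsEuclidean.weylGroup_eq (hP : IsEuclidean P) (b : P.Base) :
    weylGroup P = parabolic P (b.support : Set ι) := by
  refine le_antisymm ((Subgroup.closure_le _).mpr ?_)
    (Subgroup.closure_mono (Set.image_subset_range _ _))
  rintro _ ⟨i, rfl⟩
  rcases exists_mem_posRoots_or_neg b i with h | h
  · exact (refl_mem_parabolic_and_coroot_mem hP subset_rfl h).1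
  · have := (refl_mem_parabolic_and_coroot_mem hP subset_rfl h).1
    rwa [refl_reflectionPerm, refl_mul_self, one_mul] at this

theorem IsEuclidean.corootLattice_eq (hP : IsEuclidean P) (b : P.Base) :
    corootLattice P = parabolicLattice P (b.support : Set ι) := by
  refine le_antisymm ((AddSubgroup.closure_le _).mpr ?_)
    (AddSubgroup.closure_mono (Set.image_subset_range _ _))
  rintro _ ⟨i, rfl⟩
  rcases exists_mem_posRoots_or_neg b i with h | h
  · exact (refl_mem_parabolic_and_coroot_mem hP subset_rfl h).2
  · have := (refl_mem_parabolic_and_coroot_mem hP subset_rfl h).2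
    rwa [P.coroot_reflectionPerm, P.coreflection_apply_self, neg_mem_iff] at this

theorem IsEuclidean.affineWeylGroup_eq (hP : IsEuclidean P) (b : P.Base) :
    affineWeylGroup P = affineParabolic P (b.support : Set ι) := by
  rw [affineWeylGroup, affineParabolic, hP.weylGroup_eq b, hP.corootLattice_eq b]

theorem IsEuclidean.affineParabolic_le (hP : IsEuclidean P) (hJ : J ⊆ (b.support : Set ι)) :
    affineParabolic P J ≤ affineWeylGroup P := by
  rw [hP.affineWeylGroup_eq b]
  exact affineParabolic_mono hJ

/-! ### Minimal coset representatives -/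

theorem IsEuclidean.length_set_nonempty (hP : IsEuclidean P) {u : RightAff V}
    (hu : u ∈ weylGroup P) :
    {k | ∃ l : List ι, (∀ i ∈ l, i ∈ b.support) ∧ l.length = k ∧
      (l.map (refl P)).prod = u}.Nonempty := by
  rw [hP.weylGroup_eq b] at hu
  obtain ⟨l, h1, h2⟩ := exists_word_of_mem_closure (refl_mul_self (P := P)) hu
  exact ⟨_, l, h1, rfl, h2⟩

/-- A minimal coset representative `u` sends the chamber of `W` into the chamber of `W_J`:
if `u` made `α_j` negative for some `j ∈ J`, then `u s_j` would be shorter than `u`. -/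
theorem IsEuclidean.minCosetReps_subset (hP : IsEuclidean P) (hJ : J ⊆ (b.support : Set ι)) :
    minCosetReps P b J ⊆ fundAlcove P b J := by
  rintro u ⟨hu, hmin⟩
  refine ⟨Subgroup.mem_sup_left hu, fun y hy ↦ ?_⟩
  obtain ⟨l, hl, hlen, hprod⟩ := Nat.sInf_mem (hP.length_set_nonempty (b := b) hu)
  have hsimple : ∀ j ∈ J, 0 < (inner ℝ (act y u) (P.root j) : ℝ) := by
    intro j hj
    have hpos : b.IsPos (l.foldr (fun t i ↦ P.reflectionPerm t i) j) := by
      by_contra hneg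
      obtain ⟨l', h1, h2, h3⟩ := exists_shorter_word (r := refl P) (pos := b.IsPos)
        (T := (b.support : Set ι)) refl_mul_self refl_reflectionPerm
        (fun t ht a ha hna ↦ by
          by_contra hne
          exact hna (ha.reflectionPerm ht hne))
        (RootPairing.Base.isPos_of_mem_support (hJ hj)) l hl hneg
      have h4 : length P b (u * refl P j) ≤ l'.length :=
        Nat.sInf_le ⟨l', h1, rfl, by rw [h3, hprod]⟩
      have h5 := hmin (refl P j) (Subgroup.subset_closure ⟨j, hj, rfl⟩)
      have h6 : l.length = length P b u := hlen
      omega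
    rw [← hprod, hP.inner_act_word]
    exact (hy _ (mem_posRoots_support_iff.mpr hpos)).1
  intro i hi
  have h1 := inner_pos_of_mem_posRoots hsimple hi
  refine ⟨h1, ?_⟩
  rw [← hprod, hP.inner_act_word] at h1 ⊢
  set i' := l.foldr (fun t i ↦ P.reflectionPerm t i) i
  rcases exists_mem_posRoots_or_neg b i' with h | h
  · exact (hy _ h).2
  · have := (hy _ h).1
    rw [root_neg, inner_neg_right] at this
    linarith

theorem IsEuclidean.exists_mul_mem_minCosetReps (hP : IsEuclidean P)
    (hJ : J ⊆ (b.support : Set ι)) {u : RightAff V} (hu : u ∈ weylGroup P) :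
    ∃ v ∈ parabolic P J, u * v ∈ minCosetReps P b J := by
  obtain ⟨v, hv, hmin⟩ := exists_minimalFor_of_wellFoundedLT (fun v ↦ v ∈ parabolic P J)
    (fun v ↦ length P b (u * v)) ⟨1, one_mem _⟩
  refine ⟨v, hv, mul_mem hu ?_, fun v' hv' ↦ ?_⟩
  · rw [hP.weylGroup_eq b]
    exact parabolic_mono hJ hv
  · rw [mul_assoc]
    rcases le_total (length P b (u * v)) (length P b (u * (v * v'))) with h | h
    · exact h
    · exact hmin (mul_mem hv hv') h

/-! ### Alcoves in the fundamental alcove of a parabolic subsystem -/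

variable [FiniteDimensional ℝ V] [P.IsRootSystem]

theorem IsEuclidean.exists_affEval_act_eq (hP : IsEuclidean P) (b : P.Base) {x : RightAff V}
    (hx : x ∈ affineWeylGroup P) (a : ι × ℤ) :
    ∃ a' : ι × ℤ, ∀ y, affEval P a (act y x) = affEval P a' y := by
  rw [hP.affineWeylGroup_eq b, hP.affineParabolic_eq_closure (b := b) subset_rfl] at hx
  obtain ⟨l, -, rfl⟩ := exists_word_of_mem_closure hP.affRefl_mul_self hx
  exact ⟨_, fun y ↦ (hP.affEval_foldr_affAct l a y).symm⟩

/-- No hyperplane of `Φ_J` meets an alcove, so an alcove lies in `𝒜_J` as soon as one of its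
points does. -/
theorem IsEuclidean.mem_fundAlcove (hP : IsEuclidean P) {x : RightAff V}
    (hx : x ∈ affineWeylGroup P) {y : V} (hy : y ∈ region P (b.support : Set ι))
    (hyx : act y x ∈ region P J) : x ∈ fundAlcove P b J := by
  refine ⟨hx, fun z hz i hi ↦ ?_⟩
  obtain ⟨⟨j, k⟩, hjk⟩ := hP.exists_affEval_act_eq b hx (i, 0)
  have hval : ∀ u : V, (inner ℝ (act u x) (P.root i) : ℝ) = affEval P (j, k) u := fun u ↦ by
    rw [← hjk]; simp [affEval]
  -- the upper bound `1` is the positivity of the complementary affine root `1 - a`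
  have hcompl : ∀ u : V, affEval P (P.reflectionPerm j j, 1 - k) u = 1 - affEval P (j, k) u := by
    intro u
    simp only [affEval, root_neg, inner_neg_right, Int.cast_sub, Int.cast_one]
    ring
  obtain ⟨h1, h2⟩ := hyx i hi
  rw [hval] at h1 h2 ⊢
  have h3 := affEval_pos_of_affEval_pos (a := (P.reflectionPerm j j, 1 - k)) hy hz
    (by rw [hcompl]; linarith)
  rw [hcompl] at h3
  exact ⟨affEval_pos_of_affEval_pos hy hz h1, by linarith⟩

theorem IsEuclidean.exists_mul_mem_fundAlcove (hP : IsEuclidean P)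
    (hJ : J ⊆ (b.support : Set ι)) {x : RightAff V} (hx : x ∈ affineWeylGroup P) :
    ∃ w ∈ affineParabolic P J, x * w ∈ fundAlcove P b J := by
  obtain ⟨y, hy⟩ := region_support_nonempty b
  obtain ⟨w, hw, h⟩ := hP.exists_act_mem_region hJ (y := act y x) fun a ↦ by
    obtain ⟨a', ha'⟩ := hP.exists_affEval_act_eq b hx a
    rw [ha']
    exact affEval_ne_zero hy a'
  exact ⟨w, hw, hP.mem_fundAlcove (mul_mem hx (hP.affineParabolic_le hJ hw)) hy h⟩

theorem IsEuclidean.eq_of_mul_mem_fundAlcove (hP : IsEuclidean P)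
    (hJ : J ⊆ (b.support : Set ι)) {x w w' : RightAff V} (hw : w ∈ affineParabolic P J)
    (hw' : w' ∈ affineParabolic P J) (h : x * w ∈ fundAlcove P b J)
    (h' : x * w' ∈ fundAlcove P b J) : w = w' := by
  obtain ⟨y, hy⟩ := region_support_nonempty b
  have h1 := hP.eq_one_of_act_mem_region hJ (mul_mem (inv_mem hw) hw') (h.2 y hy) (by
    rw [← act_mul, ← mul_assoc, mul_inv_cancel_right]
    exact h'.2 y hy)
  exact inv_mul_eq_one.mp h1

theorem IsEuclidean.fold_eq (hP : IsEuclidean P) (hJ : J ⊆ (b.support : Set ι))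
    {x w : RightAff V} (hw : w ∈ affineParabolic P J) (h : x * w ∈ fundAlcove P b J) :
    fold P b J x = x * w := by
  have hex : ∃ w ∈ affineParabolic P J, x * w ∈ fundAlcove P b J := ⟨w, hw, h⟩
  rw [fold, dif_pos hex,
    hP.eq_of_mul_mem_fundAlcove hJ hex.choose_spec.1 hw hex.choose_spec.2 h]

theorem IsEuclidean.exists_fold_eq (hP : IsEuclidean P) (hJ : J ⊆ (b.support : Set ι))
    {x : RightAff V} (hx : x ∈ affineWeylGroup P) :
    ∃ w ∈ affineParabolic P J, fold P b J x = x * w ∧ x * w ∈ fundAlcove P b J := by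
  obtain ⟨w, hw, h⟩ := hP.exists_mul_mem_fundAlcove hJ hx
  exact ⟨w, hw, hP.fold_eq hJ hw h, h⟩

/-- The folding map is constant on the left cosets of `W_J ⋉ Q^∨_J`. -/
theorem IsEuclidean.fold_mul (hP : IsEuclidean P) (hJ : J ⊆ (b.support : Set ι))
    {x v : RightAff V} (hx : x ∈ affineWeylGroup P) (hv : v ∈ affineParabolic P J) :
    fold P b J (x * v) = fold P b J x := by
  obtain ⟨w, hw, h1, h2⟩ := hP.exists_fold_eq hJ hx
  have h3 : x * v * (v⁻¹ * w) = x * w := by group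
  rw [h1, hP.fold_eq hJ (mul_mem (inv_mem hv) hw) (by rwa [h3]), h3]

theorem IsEuclidean.pseudoTransl_latticeClass (hP : IsEuclidean P)
    (hJ : J ⊆ (b.support : Set ι)) {x : RightAff V} (hx : x ∈ affineWeylGroup P)
    (α : corootLattice P) :
    pseudoTransl P b J x (latticeClass P J α) = fold P b J (x * transl (α : V)) := by
  set γ : corootLattice P := Quotient.out (latticeClass P J α) with hγ
  have hmk : (QuotientAddGroup.mk α : LatticeQuotient P J) = QuotientAddGroup.mk γ :=
    (Quotient.out_eq (latticeClass P J α)).symm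
  rw [QuotientAddGroup.eq, AddSubgroup.mem_addSubgroupOf] at hmk
  have hxα : x * transl (α : V) ∈ affineWeylGroup P :=
    mul_mem hx (Subgroup.mem_sup_right (Subgroup.subset_closure ⟨α, α.2, rfl⟩))
  rw [pseudoTransl, ← hγ, ← hP.fold_mul hJ hxα (transl_mem_affineParabolic hmk), mul_assoc,
    ← transl_add]
  simp

/-! ### The bijection -/

theorem IsEuclidean.bijOn_pseudoTransl (hP : IsEuclidean P) (hJ : J ⊆ (b.support : Set ι)) :
    Set.BijOn
      (fun p : RightAff V × LatticeQuotient P J ↦ pseudoTransl P b J p.1 p.2)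
      (minCosetReps P b J ×ˢ Set.univ) (fundAlcove P b J) := by
  have hmin : ∀ u ∈ minCosetReps P b J, u ∈ affineWeylGroup P := fun u hu ↦
    Subgroup.mem_sup_left hu.1
  have hmul : ∀ u ∈ minCosetReps P b J, ∀ α : corootLattice P,
      u * transl (α : V) ∈ affineWeylGroup P := fun u hu α ↦
    mul_mem (hmin u hu) (Subgroup.mem_sup_right (Subgroup.subset_closure ⟨α, α.2, rfl⟩))
  refine ⟨?_, ?_, ?_⟩
  · rintro ⟨u, a⟩ ⟨hu, -⟩
    obtain ⟨α, rfl⟩ := QuotientAddGroup.mk_surjective a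
    obtain ⟨w, -, h1, h2⟩ := hP.exists_fold_eq hJ (hmul u hu α)
    have h3 := hP.pseudoTransl_latticeClass hJ (hmin u hu) α
    rw [h1] at h3
    rw [← h3] at h2
    exact h2
  · rintro ⟨u, a⟩ ⟨hu, -⟩ ⟨u', a'⟩ ⟨hu', -⟩ heq
    obtain ⟨α, rfl⟩ := QuotientAddGroup.mk_surjective a
    obtain ⟨α', rfl⟩ := QuotientAddGroup.mk_surjective a'
    simp only at hu hu'
    have e := hP.pseudoTransl_latticeClass hJ (hmin u hu) α
    have e' := hP.pseudoTransl_latticeClass hJ (hmin u' hu') α'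
    obtain ⟨w, hw, h1, -⟩ := hP.exists_fold_eq hJ (hmul u hu α)
    obtain ⟨w', hw', h1', -⟩ := hP.exists_fold_eq hJ (hmul u' hu' α')
    have heq2 : u * transl (α : V) * w = u' * transl (α' : V) * w' := by
      rw [← h1, ← h1', ← e, ← e']
      exact heq
    obtain ⟨v, hv, β, hβ, hvβ⟩ := hP.exists_eq_mul_transl (mul_mem hw (inv_mem hw'))
    have heq3 : u * transl (α : V) * (v * transl β) = u' * transl (α' : V) := by
      rw [← hvβ, ← mul_assoc, heq2, mul_inv_cancel_right]
    have heq4 : u * v * transl (act (α : V) v + β) = u' * transl (α' : V) := by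
      rw [← heq3, transl_add, mul_assoc u v, ← mul_assoc v, ← hP.transl_mul_of_mem_parabolic hv]
      simp only [mul_assoc]
    -- evaluation at the origin separates the linear part from the translation part
    have hW : ∀ g ∈ weylGroup P, act (0 : V) g = 0 := fun g hg ↦ by
      rw [hP.weylGroup_eq b] at hg
      exact hP.act_zero_of_mem_parabolic hg
    have hvW : v ∈ weylGroup P := by
      rw [hP.weylGroup_eq b]
      exact parabolic_mono hJ hv
    have htr : act (α : V) v + β = (α' : V) := by
      have := congrArg (act (0 : V)) heq4
      simpa [hW u hu.1, hW u' hu'.1, hW v hvW] using this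
    rw [htr] at heq4
    have huv : u * v = u' := mul_right_cancel heq4
    have hv1 : v = 1 := by
      refine hP.eq_of_mul_mem_fundAlcove (x := u) hJ (Subgroup.mem_sup_left hv) (one_mem _) ?_ ?_
      · rw [huv]
        exact hP.minCosetReps_subset hJ hu'
      · rw [mul_one]
        exact hP.minCosetReps_subset hJ hu
    rw [hv1, mul_one] at huv
    rw [hv1, act_one] at htr
    refine Prod.ext huv ?_
    change (QuotientAddGroup.mk α : LatticeQuotient P J) = QuotientAddGroup.mk α'
    rw [QuotientAddGroup.eq, AddSubgroup.mem_addSubgroupOf]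
    convert hβ using 1
    simp [← htr]
  · -- the factor in `W_J` of the linear part of `x` is moved past the translation
    intro x hx
    have hxW := hx.1
    rw [hP.affineWeylGroup_eq b] at hxW
    obtain ⟨u, hu, β, hβ, rfl⟩ := hP.exists_eq_mul_transl hxW
    obtain ⟨v, hv, huv⟩ := hP.exists_mul_mem_minCosetReps (b := b) hJ
      (show u ∈ weylGroup P by rwa [hP.weylGroup_eq b])
    have hα : act β v ∈ corootLattice P := by
      rw [hP.corootLattice_eq b]
      exact hP.act_mem_parabolicLattice (parabolic_mono hJ hv) hβ
    refine ⟨(u * v, latticeClass P J ⟨_, hα⟩), ⟨huv, trivial⟩, ?_⟩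
    have heq : u * v * transl (act β v) * v⁻¹ = u * transl β := by
      rw [mul_assoc u, ← hP.transl_mul_of_mem_parabolic hv]
      group
    simp only
    rw [hP.pseudoTransl_latticeClass hJ (hmin _ huv),
      hP.fold_eq hJ (inv_mem (Subgroup.mem_sup_left hv)) (by rwa [heq]), heq]

end WeylGroup

end JAlcove

end

theorem mainTheorem9 {ι V : Type*} [Finite ι] [NormedAddCommGroup V] [InnerProductSpace ℝ V]
    [FiniteDimensional ℝ V]
    (P : RootPairing ι ℝ V V) [P.IsRootSystem] [P.IsCrystallographic] [P.IsReduced]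
    [P.IsIrreducible] (hP : JAlcove.IsEuclidean P)
    (b : P.Base) (J : Set ι) (hJ : J ⊆ (b.support : Set ι)) :
    -- each element of `W_a` is folded into `𝒜_J` by exactly one element of `W_J ⋉ Q^∨_J`
    (∀ x ∈ JAlcove.affineWeylGroup P,
      ∃! w : JAlcove.RightAff V,
        w ∈ JAlcove.affineParabolic P J ∧ x * w ∈ JAlcove.fundAlcove P b J) ∧
    -- `x • t_ᾱ = p_J(x t_α)` for every representative `α` of `ᾱ`
    (∀ x ∈ JAlcove.fundAlcove P b J, ∀ α : JAlcove.corootLattice P,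
      JAlcove.pseudoTransl P b J x (JAlcove.latticeClass P J α) =
        JAlcove.fold P b J (x * JAlcove.transl (α : V))) ∧
    -- the action on `𝒜_J` can be evaluated at the elements of `W^J`
    JAlcove.minCosetReps P b J ⊆ JAlcove.fundAlcove P b J ∧
    -- the map `(u, ᾱ) ↦ u • t_ᾱ` from `W^J × Q^∨/Q^∨_J` to `𝒜_J` is a bijection
    Set.BijOn
      (fun p : JAlcove.RightAff V × JAlcove.LatticeQuotient P J =>
        JAlcove.pseudoTransl P b J p.1 p.2)
      (JAlcove.minCosetReps P b J ×ˢ Set.univ) (JAlcove.fundAlcove P b J) := by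
  refine ⟨fun x hx ↦ ?_, fun x hx α ↦ hP.pseudoTransl_latticeClass hJ hx.1 α,
    hP.minCosetReps_subset hJ, hP.bijOn_pseudoTransl hJ⟩
  obtain ⟨w, hw, h⟩ := hP.exists_mul_mem_fundAlcove hJ hx
  exact ⟨w, ⟨hw, h⟩, fun w' hw' ↦ hP.eq_of_mul_mem_fundAlcove hJ hw'.1 hw hw'.2 h⟩
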